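/- Let $K$ be a field, let $n\ge 3$ and $k\ge 1$ be integers, and let $S=K[x_1,\dots,x_n]$ with its standard $\mathbb{Z}^n$-grading. Let $C_n^k$ be the $k$-th power of the cycle on $n$ vertices, that is, the simple graph on $\{1,\dots,n\}$ in which distinct vertices $i,j$ are adjacent if and only if $|j-i|\le k$ or $|j-i|\ge n-k$, and let $I(C_n^k)=(x_ix_j : \{i,j\}\in E(C_n^k))\subset S$ be its edge ideal. For a nonzero finitely generated $\mathbb{Z}^n$-graded $S$-module $M$, a Stanley decomposition of $M$ is a presentation of the $K$-vector space $M$ as a finite direct sum $\mathcal{D}: M=\bigoplus_{i=1}^{s}v_iK[W_i]$, where each $v_i\in M$ is homogeneous, $W_i\subseteq\{x_1,\dots,x_n\}$, $v_iK[W_i]$ is the $K$-subspace spanned by all $v_iw$ with $w$ a monomial in $K[W_i]$, and $v_iK[W_i]$ is a free $K[W_i]$-module with basis $v_i$. Put $\operatorname{sdepth}(\mathcal{D})=\min_i|W_i|$, and let the Stanley depth $\operatorname{sdepth}(M)$ be the maximum of $\operatorname{sdepth}(\mathcal{D})$ over all Stanley decompositions $\mathcal{D}$ of $M$. Then $$\operatorname{sdepth}(S/I(C_n^k))=1\quad\text{if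 } n\le 2k+1,$$ $$\operatorname{sdepth}(S/I(C_n^k))\ge\left\lceil\frac{n-k}{2k+1}\right\rceil\quad\text{if } n\ge 2k+2.$$ -/

import Mathlib

noncomputable section

namespace StanleyDepth

open MvPolynomial

section General

variable {K σ M : Type*} [Field K] [AddCommGroup M] [Module K M] [Module (MvPolynomial σ K) M]

/-- The `K`-subspace `v K[W]` of an `S`-module `M`, where `S = K[x_i : i ∈ σ]`: it is spanned over
`K` by the elements `w • v`, where `w` runs over the monomials in the variables `x_i`, `i ∈ W`. -/
def stanleySpace (K : Type*) [Field K] [Module K M] [Module (MvPolynomial σ K) M]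
    (v : M) (W : Finset σ) : Submodule K M :=
  Submodule.span K {x | ∃ m : σ →₀ ℕ, m.support ⊆ W ∧ x = (monomial m (1 : K)) • v}

/-- `v K[W]` is a free `K[W]`-module with basis `v` (in particular `v ≠ 0`): no nonzero polynomial
in the variables `x_i`, `i ∈ W`, annihilates `v`. -/
def IsFreeOn (K : Type*) [Field K] [Module (MvPolynomial σ K) M] (v : M) (W : Finset σ) : Prop :=
  ∀ p ∈ MvPolynomial.supported K (W : Set σ), p • v = 0 → p = 0

/-- A Stanley decomposition of an `S`-module `M` with `ℤ^σ`-grading `ℳ` (`ℳ a` is the homogeneous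
component of degree `a`): a presentation of the `K`-vector space `M` as a finite (internal) direct
sum of Stanley spaces `v_i K[W_i]` with `v_i` homogeneous. -/
structure StanleyDecomposition (ℳ : (σ → ℤ) → Submodule K M) where
  /-- the number of summands -/
  s : ℕ
  /-- the generators -/
  v : Fin s → M
  /-- the sets of variables -/
  W : Fin s → Finset σ
  homogeneous : ∀ i, ∃ a, v i ∈ ℳ a
  free : ∀ i, IsFreeOn K (v i) (W i)
  isInternal : DirectSum.IsInternal fun i => stanleySpace K (v i) (W i)

/-- The Stanley depth of a Stanley decomposition: the minimum of the numbers `|W_i|`. (A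
decomposition of a nonzero module has at least one summand.) -/
def StanleyDecomposition.sdepth {ℳ : (σ → ℤ) → Submodule K M}
    (D : StanleyDecomposition ℳ) : ℕ :=
  ⨅ i, (D.W i).card

/-- The Stanley depth of a graded module: the maximum of the Stanley depths of its Stanley
decompositions. (For finitely many variables these are bounded by the number of variables.) -/
def sdepth (ℳ : (σ → ℤ) → Submodule K M) : ℕ :=
  sSup (Set.range fun D : StanleyDecomposition ℳ => D.sdepth)

end General

/-- The `ℤ^σ`-grading of `S/I` for a monomial ideal `I` of `S = K[x_i : i ∈ σ]`: the component of
degree `a` is spanned by the class of the monomial `x^a`, and is zero if `a` has a negative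
entry. -/
def quotientGrading {K σ : Type*} [Field K] (I : Ideal (MvPolynomial σ K)) (a : σ → ℤ) :
    Submodule K (MvPolynomial σ K ⧸ I) :=
  Submodule.span K {x | ∃ m : σ →₀ ℕ, (∀ i, (m i : ℤ) = a i) ∧
    x = Ideal.Quotient.mk I (monomial m (1 : K))}

/-- The edge ideal `I(G) = (x_i x_j : {i, j} ∈ E(G))`. -/
def edgeIdeal (K : Type*) [Field K] {V : Type*} (G : SimpleGraph V) : Ideal (MvPolynomial V K) :=
  Ideal.span {p | ∃ i j, G.Adj i j ∧ p = X i * X j}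

/-- The `k`-th power `C_n^k` of the cycle `C_n`, with the vertices labelled `0, …, n - 1`: distinct
`i, j` are adjacent iff `|j - i| ≤ k` or `|j - i| ≥ n - k`. -/
def cyclePower (n k : ℕ) : SimpleGraph (Fin n) where
  Adj i j := i ≠ j ∧ (|(j : ℤ) - (i : ℤ)| ≤ (k : ℤ) ∨ (n : ℤ) - (k : ℤ) ≤ |(j : ℤ) - (i : ℤ)|)
  symm := ⟨fun i j h => ⟨h.1.symm, by rw [abs_sub_comm]; exact h.2⟩⟩
  loopless := ⟨fun _ h => h.1 rfl⟩

end StanleyDepth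

end

/-! A monomial lies outside the edge ideal exactly when its support is independent, so such
monomials give a `K`-basis of the quotient. If the independent sets are partitioned into intervals
`[A, B]`, grouping this basis by support gives the Stanley decomposition with summands `x^A K[B]`
(`exists_stanleyDecomposition`). It therefore suffices to find partitions with large tops `B`.

These are built by splitting at a vertex `v` into deletion and link: intervals of the link gain `v`,
so the link may have depth one less. On a line, removing the neighbours of the leftmost vertex
isolates it, and depth one costs at most `2k+1` vertices. On the cycle, deleting `k` consecutive
vertices leaves a linear graph, and the links of the deleted vertices are linear too. This gives
depth `⌊(n+k)/(2k+1)⌋ = ⌈(n-k)/(2k+1)⌉`.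

If `n ≤ 2k+1` the graph is complete, and freeness of a Stanley space forces its variables to be
independent, so the depth is at most one. -/

namespace StanleyDepth

open MvPolynomial

/-! ### Interval partitions of independent sets -/

section Combinatorics

variable {V : Type*}

/-- `F` is an independent set of vertices of `G`. -/
def IsIndependent (G : SimpleGraph V) (F : Finset V) : Prop :=
  ∀ i ∈ F, ∀ j ∈ F, ¬ G.Adj i j

/-- The independent subsets of `U` can be partitioned into intervals `[A, B]` with `d ≤ |B|`. -/
def HasIntervalPartition (G : SimpleGraph V) (U : Finset V) (d : ℕ) : Prop :=
  ∃ P : Finset (Finset V × Finset V),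
    (∀ p ∈ P, p.1 ⊆ p.2 ∧ p.2 ⊆ U ∧ IsIndependent G p.2 ∧ d ≤ p.2.card) ∧
    ∀ F ⊆ U, IsIndependent G F → ∃! p, p ∈ P ∧ p.1 ⊆ F ∧ F ⊆ p.2

variable {G : SimpleGraph V}

lemma IsIndependent.mono {F F' : Finset V} (h : IsIndependent G F) (hF : F' ⊆ F) :
    IsIndependent G F' :=
  fun i hi j hj => h i (hF hi) j (hF hj)

lemma IsIndependent.insert [DecidableEq V] {F : Finset V} {v : V} (h : IsIndependent G F)
    (hv : ∀ w ∈ F, ¬ G.Adj v w) : IsIndependent G (insert v F) := by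
  intro i hi j hj
  rw [Finset.mem_insert] at hi hj
  rcases hi with rfl | hi <;> rcases hj with rfl | hj
  · exact G.loopless.irrefl _
  · exact hv j hj
  · exact fun h' => hv i hi h'.symm
  · exact h i hi j hj

lemma hasIntervalPartition_zero (U : Finset V) : HasIntervalPartition G U 0 := by
  classical
  refine ⟨(U.powerset.filter (IsIndependent G)).image fun F => (F, F), ?_, ?_⟩
  · intro p hp
    simp only [Finset.mem_image, Finset.mem_filter, Finset.mem_powerset] at hp
    obtain ⟨F, ⟨h1, h2⟩, rfl⟩ := hp
    exact ⟨subset_rfl, h1, h2, Nat.zero_le _⟩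
  · intro F hF hI
    refine ⟨(F, F), ⟨Finset.mem_image_of_mem _ (by simp [hF, hI]), subset_rfl, subset_rfl⟩, ?_⟩
    rintro p ⟨hp, h1, h2⟩
    simp only [Finset.mem_image, Finset.mem_filter, Finset.mem_powerset] at hp
    obtain ⟨F', -, rfl⟩ := hp
    simp only at h1 h2
    rw [h1.antisymm h2]

open Classical in
/-- The independent sets avoiding `v` are those of the deletion of `v`; those containing `v`
correspond to the independent sets of the link of `v`. -/
lemma HasIntervalPartition.of_delete [DecidableEq V] {U : Finset V} {d : ℕ} (v : V) (hv : v ∈ U)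
    (h₁ : HasIntervalPartition G (U.erase v) (d + 1))
    (h₂ : HasIntervalPartition G ((U.erase v).filter fun w => ¬ G.Adj v w) d) :
    HasIntervalPartition G U (d + 1) := by
  obtain ⟨P, hP, hP'⟩ := h₁
  obtain ⟨Q, hQ, hQ'⟩ := h₂
  have hPv : ∀ p ∈ P, v ∉ p.2 := fun p hp hvp => by simpa using (hP p hp).2.1 hvp
  have hQv : ∀ q ∈ Q, v ∉ q.2 := fun q hq hvq => by simpa using (hQ q hq).2.1 hvq
  refine ⟨P ∪ Q.image fun q => (insert v q.1, insert v q.2), ?_, ?_⟩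
  · intro p hp
    rw [Finset.mem_union, Finset.mem_image] at hp
    rcases hp with hp | ⟨q, hq, rfl⟩
    · obtain ⟨a, b, c, e⟩ := hP p hp
      exact ⟨a, b.trans (Finset.erase_subset _ _), c, e⟩
    · obtain ⟨a, b, c, e⟩ := hQ q hq
      refine ⟨Finset.insert_subset_insert _ a, ?_, ?_, ?_⟩
      · refine Finset.insert_subset hv (b.trans ?_)
        exact (Finset.filter_subset _ _).trans (Finset.erase_subset _ _)
      · exact c.insert fun w hw => (Finset.mem_filter.1 (b hw)).2
      · rw [Finset.card_insert_of_notMem (hQv q hq)]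
        omega
  · intro F hF hI
    by_cases hvF : v ∈ F
    · have hsub : F.erase v ⊆ (U.erase v).filter fun w => ¬ G.Adj v w := by
        intro w hw
        rw [Finset.mem_erase] at hw
        simp only [Finset.mem_filter, Finset.mem_erase]
        exact ⟨⟨hw.1, hF hw.2⟩, hI v hvF w hw.2⟩
      obtain ⟨q, ⟨hq, hq1, hq2⟩, huniq⟩ := hQ' _ hsub (hI.mono (Finset.erase_subset _ _))
      refine ⟨(insert v q.1, insert v q.2), ⟨?_, ?_, ?_⟩, ?_⟩
      · exact Finset.mem_union_right _ (Finset.mem_image_of_mem _ hq)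
      · exact Finset.insert_subset hvF (hq1.trans (Finset.erase_subset _ _))
      · exact Finset.subset_insert_iff.2 hq2
      · rintro p ⟨hp, hp1, hp2⟩
        rw [Finset.mem_union, Finset.mem_image] at hp
        rcases hp with hp | ⟨q', hq', rfl⟩
        · exact absurd (hp2 hvF) (hPv p hp)
        · have hv1 : v ∉ q'.1 := fun h => hQv q' hq' ((hQ q' hq').1 h)
          have : q' = q := by
            refine huniq q' ⟨hq', ?_, Finset.subset_insert_iff.1 hp2⟩
            intro w hw
            refine Finset.mem_erase.2 ⟨?_, hp1 (Finset.mem_insert_of_mem hw)⟩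
            rintro rfl
            exact hv1 hw
          rw [this]
    · have hsub : F ⊆ U.erase v := fun w hw =>
        Finset.mem_erase.2 ⟨fun h => hvF (h ▸ hw), hF hw⟩
      obtain ⟨p, ⟨hp, hp1, hp2⟩, huniq⟩ := hP' F hsub hI
      refine ⟨p, ⟨Finset.mem_union_left _ hp, hp1, hp2⟩, ?_⟩
      rintro p' ⟨hp', hp1', hp2'⟩
      rw [Finset.mem_union, Finset.mem_image] at hp'
      rcases hp' with hp' | ⟨q', -, rfl⟩
      · exact huniq p' ⟨hp', hp1', hp2'⟩
      · exact absurd (hp1' (Finset.mem_insert_self _ _)) hvF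

open Classical in
-- The independence complex is a cone with apex `v`, so each interval `[A, B]` of the base extends
-- to `[A, B ∪ {v}]`.
lemma HasIntervalPartition.of_isolated [DecidableEq V] {U : Finset V} {d : ℕ} (v : V) (hv : v ∈ U)
    (hadj : ∀ w ∈ U, ¬ G.Adj v w) (h : HasIntervalPartition G (U.erase v) d) :
    HasIntervalPartition G U (d + 1) := by
  obtain ⟨P, hP, hP'⟩ := h
  have hPv : ∀ p ∈ P, v ∉ p.2 := fun p hp hvp => by simpa using (hP p hp).2.1 hvp
  refine ⟨P.image fun p => (p.1, insert v p.2), ?_, ?_⟩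
  · intro p hp
    obtain ⟨q, hq, rfl⟩ := Finset.mem_image.1 hp
    obtain ⟨a, b, c, e⟩ := hP q hq
    have hb : q.2 ⊆ U := b.trans (Finset.erase_subset _ _)
    refine ⟨a.trans (Finset.subset_insert _ _), Finset.insert_subset hv hb,
      c.insert fun w hw => hadj w (hb hw), ?_⟩
    rw [Finset.card_insert_of_notMem (hPv q hq)]
    omega
  · intro F hF hI
    obtain ⟨p, ⟨hp, hp1, hp2⟩, huniq⟩ := hP' (F.erase v) (Finset.erase_subset_erase v hF)
      (hI.mono (Finset.erase_subset _ _))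
    refine ⟨(p.1, insert v p.2), ⟨Finset.mem_image_of_mem _ hp,
      hp1.trans (Finset.erase_subset _ _), Finset.subset_insert_iff.2 hp2⟩, ?_⟩
    rintro p' ⟨hp', hp1', hp2'⟩
    obtain ⟨q, hq, rfl⟩ := Finset.mem_image.1 hp'
    have hv1 : v ∉ q.1 := fun h => hPv q hq ((hP q hq).1 h)
    have : q = p := by
      refine huniq q ⟨hq, ?_, Finset.subset_insert_iff.1 hp2'⟩
      exact fun w hw => Finset.mem_erase.2 ⟨fun h => hv1 (h ▸ hw), hp1' hw⟩
    rw [this]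

open Classical in
/-- Delete the vertices of `D` one after the other. -/
lemma HasIntervalPartition.of_sdiff [DecidableEq V] {U D : Finset V} {d : ℕ} (hD : D ⊆ U)
    (h : HasIntervalPartition G (U \ D) (d + 1))
    (hlink : ∀ w ∈ D, ∀ D' ⊆ D,
      HasIntervalPartition G (((U \ D').erase w).filter fun x => ¬ G.Adj w x) d) :
    HasIntervalPartition G U (d + 1) := by
  -- `E` is the set of vertices already put back; each return applies `of_delete` with `D \ E` still
  -- absent.
  have key : ∀ E ⊆ D, HasIntervalPartition G (U \ (D \ E)) (d + 1) := by
    intro E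
    induction E using Finset.induction_on with
    | empty => intro _; simpa using h
    | insert w E hw ih =>
      intro hE
      have hwD : w ∈ D := hE (Finset.mem_insert_self _ _)
      have hED : E ⊆ D := (Finset.subset_insert _ _).trans hE
      refine HasIntervalPartition.of_delete w (by simp [hD hwD]) ?_
        (hlink w hwD _ Finset.sdiff_subset)
      convert ih hED using 1
      ext x
      simp only [Finset.mem_erase, Finset.mem_sdiff, Finset.mem_insert]
      by_cases hx : x = w
      · subst hx; simp [hw, hwD]
      · simp [hx]
  simpa using key D subset_rfl

/-- Delete all vertices but one: the survivor is isolated, and links need only depth zero. -/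
lemma hasIntervalPartition_one {U : Finset V} (hU : U.Nonempty) :
    HasIntervalPartition G U 1 := by
  classical
  obtain ⟨u, hu⟩ := hU
  refine HasIntervalPartition.of_sdiff (D := U.erase u) (Finset.erase_subset _ _) ?_
    fun _ _ _ _ => hasIntervalPartition_zero _
  refine HasIntervalPartition.of_isolated u (by simp [hu]) ?_ (hasIntervalPartition_zero _)
  intro w hw
  have : w = u := by
    by_contra hne
    simp_all
  rw [this]
  exact G.loopless.irrefl _

/-- If adjacent vertices of `U` are at distance at most `k` on the line, then the independent
subsets of `U` can be partitioned into intervals whose tops have at least `|U| / (2k + 1)`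
elements. -/
lemma hasIntervalPartition_of_linear {n k : ℕ} {G : SimpleGraph (Fin n)} (d : ℕ)
    (U : Finset (Fin n))
    (hG : ∀ i ∈ U, ∀ j ∈ U, G.Adj i j → (j : ℕ) ≤ i + k)
    (hd : (2 * k + 1) * d ≤ U.card + 2 * k) : HasIntervalPartition G U d := by
  classical
  induction d generalizing U with
  | zero => exact hasIntervalPartition_zero U
  | succ d ih =>
    have hU : U.Nonempty := by
      rw [← Finset.card_pos]
      rw [mul_add] at hd
      omega
    set u := U.min' hU with hu
    have huU : u ∈ U := U.min'_mem hU
    have hmin : ∀ w ∈ U, (u : ℕ) ≤ w := fun w hw => U.min'_le w hw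
    -- A set missing only vertices in `[u, u + 2k]` has lost at most `2k + 1` of them, the price of
    -- lowering `d` by one.
    have hbig : ∀ T ⊆ U, (∀ x ∈ U, x ∉ T → (x : ℕ) ≤ u + 2 * k) →
        HasIntervalPartition G T d := by
      intro T hT hx
      refine ih T (fun i hi j hj => hG i (hT hi) j (hT hj)) ?_
      have h1 : (U \ T).card ≤ 2 * k + 1 := by
        have : ((U \ T).image fun x : Fin n => (x : ℕ)) ⊆ Finset.Icc (u : ℕ) (u + 2 * k) := by
          intro y hy
          obtain ⟨x, hxm, rfl⟩ := Finset.mem_image.1 hy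
          rw [Finset.mem_sdiff] at hxm
          exact Finset.mem_Icc.2 ⟨hmin x hxm.1, hx x hxm.1 hxm.2⟩
        have h2 := Finset.card_le_card this
        rw [Finset.card_image_of_injective _ Fin.val_injective, Nat.card_Icc] at h2
        omega
      have h3 := Finset.card_sdiff_add_card_eq_card hT
      rw [mul_add] at hd
      omega
    refine HasIntervalPartition.of_sdiff (D := U.filter (G.Adj u)) (Finset.filter_subset _ _) ?_ ?_
    · refine HasIntervalPartition.of_isolated u (by simp [huU])
        (fun w hw hadj => by simp_all) ?_
      refine hbig _ ((Finset.erase_subset _ _).trans Finset.sdiff_subset) ?_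
      intro x hx hxT
      by_cases hxu : x = u
      · rw [hxu]; omega
      · have hadj : G.Adj u x := by
          by_contra hna
          exact hxT (by simp [hx, hxu, hna])
        have := hG u huU x hx hadj
        omega
    -- A neighbour `w` of `u` is at most `u + k`, so its own neighbours are at most `u + 2k`.
    · intro w hw D' hD'
      rw [Finset.mem_filter] at hw
      have hwu := hG u huU w hw.1 hw.2
      refine hbig _ ?_ ?_
      · exact (Finset.filter_subset _ _).trans
          ((Finset.erase_subset _ _).trans Finset.sdiff_subset)
      · intro x hx hxT
        by_cases hxw : x = w
        · rw [hxw]; omega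
        · by_cases hxD : x ∈ D'
          · have := hG u huU x hx (Finset.mem_filter.1 (hD' hxD)).2
            omega
          · have hadj : G.Adj w x := by
              by_contra hna
              exact hxT (by simp [hx, hxw, hxD, hna])
            have := hG w hw.1 x hx hadj
            omega

lemma cyclePower_adj_iff {n k : ℕ} {i j : Fin n} : (cyclePower n k).Adj i j ↔
    i ≠ j ∧ (((j : ℕ) ≤ i + k ∧ (i : ℕ) ≤ j + k) ∨ n + (i : ℕ) ≤ j + k ∨ n + (j : ℕ) ≤ i + k) := by
  simp only [cyclePower, abs_le, le_abs]
  refine and_congr_right fun _ => ?_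
  omega

/-- Cutting out the first `k` vertices removes every wrap-around edge and leaves `n - k` vertices on
a line. -/
lemma hasIntervalPartition_cyclePower {n k d : ℕ} (hkn : k ≤ n)
    (hd : (2 * k + 1) * d ≤ n + k) :
    HasIntervalPartition (cyclePower n k) Finset.univ d := by
  classical
  cases d with
  | zero => exact hasIntervalPartition_zero _
  | succ d =>
    rw [mul_add] at hd
    have hcard : ∀ (T : Finset (Fin n)) (a b : ℕ), b ≤ n →
        (∀ x : Fin n, a ≤ (x : ℕ) → (x : ℕ) < b → x ∈ T) → b - a ≤ T.card := by
      intro T a b hb hT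
      have : Finset.Ico a b ⊆ T.image fun x : Fin n => (x : ℕ) := by
        intro y hy
        rw [Finset.mem_Ico] at hy
        exact Finset.mem_image.2 ⟨⟨y, by omega⟩, hT ⟨y, by omega⟩ hy.1 hy.2, rfl⟩
      have h2 := Finset.card_le_card this
      rwa [Finset.card_image_of_injective _ Fin.val_injective, Nat.card_Ico] at h2
    refine HasIntervalPartition.of_sdiff (D := Finset.univ.filter fun i : Fin n => (i : ℕ) < k)
      (Finset.subset_univ _) ?_ ?_
    · refine hasIntervalPartition_of_linear (k := k) _ _ ?_ ?_
      · intro i hi j hj hadj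
        simp only [Finset.mem_sdiff, Finset.mem_univ, Finset.mem_filter, true_and, not_lt] at hi hj
        have := (cyclePower_adj_iff.1 hadj).2
        have := i.2
        have := j.2
        omega
      · refine le_trans ?_ (Nat.add_le_add_right (hcard _ k n le_rfl (by simp)) _)
        rw [mul_add]
        omega
    · intro w hw D' hD'
      simp only [Finset.mem_filter, Finset.mem_univ, true_and] at hw
      refine hasIntervalPartition_of_linear (k := k) _ _ ?_ ?_
      -- Non-neighbours of `w < k` lie strictly between `w + k` and `n + w - k`, a window too short
      -- for wrap-around edges.
      · intro i hi j hj hadj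
        simp only [Finset.mem_sdiff, Finset.mem_univ, Finset.mem_filter, true_and, cyclePower_adj_iff,
          Finset.mem_erase, not_and, not_or, not_le, Ne] at hi hj hadj
        have hi' := hi.2 (fun h => hi.1.1 h.symm)
        have hj' := hj.2 (fun h => hj.1.1 h.symm)
        omega
      · have := hcard (((Finset.univ \ D').erase w).filter fun x => ¬ (cyclePower n k).Adj w x)
          (w + k + 1) (n + w - k) (by omega) (by
            intro x hx1 hx2
            have hxD : x ∉ D' := fun h => by
              have := (Finset.mem_filter.1 (hD' h)).2
              omega
            have hxw : x ≠ w := by rintro rfl; omega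
            simp only [Finset.mem_sdiff, Finset.mem_univ, Finset.mem_filter, true_and, cyclePower_adj_iff,
              Finset.mem_erase, not_and, not_or, not_le, Ne]
            refine ⟨⟨hxw, hxD⟩, fun _ => ?_⟩
            omega)
        omega

end Combinatorics

/-! ### From interval partitions to Stanley decompositions -/

section Algebra

variable {K : Type*} [Field K] {V : Type*} {G : SimpleGraph V}

lemma mem_edgeIdeal_iff (p : MvPolynomial V K) :
    p ∈ edgeIdeal K G ↔ ∀ m ∈ p.support, ¬ IsIndependent G m.support := by
  classical
  have h : edgeIdeal K G = Ideal.span ((fun s => monomial s (1 : K)) ''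
      {s | ∃ i j, G.Adj i j ∧ s = Finsupp.single i 1 + Finsupp.single j 1}) := by
    unfold edgeIdeal
    congr 1
    ext q
    constructor
    · rintro ⟨i, j, hij, rfl⟩
      exact ⟨_, ⟨i, j, hij, rfl⟩, by simp [X, monomial_mul]⟩
    · rintro ⟨_, ⟨i, j, hij, rfl⟩, rfl⟩
      exact ⟨i, j, hij, by simp [X, monomial_mul]⟩
  rw [h, mem_ideal_span_monomial_image]
  refine forall₂_congr fun m _ => ?_
  unfold IsIndependent
  push Not
  constructor
  · rintro ⟨_, ⟨i, j, hij, rfl⟩, hle⟩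
    have hi := hle i
    have hj := hle j
    simp only [Finsupp.add_apply, Finsupp.single_eq_same] at hi hj
    exact ⟨i, Finsupp.mem_support_iff.2 (by omega), j, Finsupp.mem_support_iff.2 (by omega), hij⟩
  · rintro ⟨i, hi, j, hj, hij⟩
    refine ⟨_, ⟨i, j, hij, rfl⟩, fun x => ?_⟩
    rw [Finsupp.mem_support_iff] at hi hj
    have hne := hij.ne
    simp only [Finsupp.add_apply, Finsupp.single_apply]
    split_ifs <;> subst_vars <;> first | omega | exact absurd rfl hne

/-- The monomial with independent support `m`, as an element of `S/I(G)`. -/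
noncomputable def standardMonomial (K : Type*) [Field K] (G : SimpleGraph V)
    (m : {m : V →₀ ℕ // IsIndependent G m.support}) : MvPolynomial V K ⧸ edgeIdeal K G :=
  Ideal.Quotient.mk _ (monomial m.1 1)

lemma linearIndependent_standardMonomial : LinearIndependent K (standardMonomial K G) := by
  classical
  rw [linearIndependent_iff']
  intro s g hg m hm
  have h1 : Ideal.Quotient.mk (edgeIdeal K G) (∑ i ∈ s, monomial i.1 (g i)) = 0 := by
    rw [← hg, map_sum]
    refine Finset.sum_congr rfl fun i _ => ?_
    rw [standardMonomial, ← mul_one (g i), ← smul_eq_mul, ← smul_monomial]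
    simp only [smul_eq_mul, mul_one]
    rfl
  rw [Ideal.Quotient.eq_zero_iff_mem, mem_edgeIdeal_iff] at h1
  by_contra hne
  refine h1 m.1 ?_ m.2
  rw [mem_support_iff, coeff_sum, Finset.sum_eq_single m]
  · simpa using hne
  · intro b _ hb
    rw [coeff_monomial, if_neg fun h => hb (Subtype.ext h)]
  · exact fun h => absurd hm h

lemma span_standardMonomial : Submodule.span K (Set.range (standardMonomial K G)) = ⊤ := by
  rw [eq_top_iff]
  rintro x -
  obtain ⟨p, rfl⟩ := Ideal.Quotient.mk_surjective x
  rw [p.as_sum, map_sum]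
  refine Submodule.sum_mem _ fun m _ => ?_
  have h : Ideal.Quotient.mk (edgeIdeal K G) (monomial m (coeff m p)) =
      coeff m p • Ideal.Quotient.mk (edgeIdeal K G) (monomial m 1) := by
    conv_lhs => rw [← mul_one (coeff m p), ← smul_eq_mul, ← smul_monomial]
    rfl
  rw [h]
  refine Submodule.smul_mem _ _ ?_
  by_cases hm : IsIndependent G m.support
  · exact Submodule.subset_span ⟨⟨m, hm⟩, rfl⟩
  · have : Ideal.Quotient.mk (edgeIdeal K G) (monomial m (1 : K)) = 0 := by
      rw [Ideal.Quotient.eq_zero_iff_mem, mem_edgeIdeal_iff]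
      intro m' hm'
      rw [Finset.mem_singleton.1 (support_monomial_subset hm')]
      exact hm
    rw [this]
    exact Submodule.zero_mem _

/-- The squarefree monomial with support `A`. -/
noncomputable def squarefreeExponent (A : Finset V) : V →₀ ℕ :=
  Finsupp.indicator A fun _ _ => 1

lemma squarefreeExponent_apply_of_mem {A : Finset V} {i : V} (hi : i ∈ A) :
    squarefreeExponent A i = 1 :=
  Finsupp.indicator_of_mem hi _

lemma squarefreeExponent_apply_of_notMem {A : Finset V} {i : V} (hi : i ∉ A) :
    squarefreeExponent A i = 0 :=
  Finsupp.indicator_of_notMem hi _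

lemma support_add_squarefreeExponent {A B : Finset V} (hAB : A ⊆ B) {m : V →₀ ℕ}
    (hm : m.support ⊆ B) :
    A ⊆ (m + squarefreeExponent A).support ∧ (m + squarefreeExponent A).support ⊆ B := by
  constructor
  · intro i hi
    rw [Finsupp.mem_support_iff, Finsupp.add_apply, squarefreeExponent_apply_of_mem hi]
    omega
  · intro i hi
    by_contra hiB
    rw [Finsupp.mem_support_iff, Finsupp.add_apply,
      squarefreeExponent_apply_of_notMem fun h => hiB (hAB h),
      Finsupp.notMem_support_iff.1 fun h => hiB (hm h)] at hi
    exact hi rfl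

/-- For `A ⊆ B`, the multiples of `x^A` by monomials in `B` are exactly the monomials with support
in `[A, B]`. -/
lemma stanleySpace_squarefree {A B : Finset V} (hAB : A ⊆ B) (hB : IsIndependent G B) :
    stanleySpace K (Ideal.Quotient.mk (edgeIdeal K G) (monomial (squarefreeExponent A) (1 : K))) B =
      Submodule.span K (standardMonomial K G '' {m | A ⊆ m.1.support ∧ m.1.support ⊆ B}) := by
  unfold stanleySpace
  congr 1
  have hmul (m : V →₀ ℕ) : (monomial m (1 : K)) •
      Ideal.Quotient.mk (edgeIdeal K G) (monomial (squarefreeExponent A) (1 : K)) =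
      Ideal.Quotient.mk (edgeIdeal K G) (monomial (m + squarefreeExponent A) 1) := by
    change Ideal.Quotient.mk _ (_ * _) = _
    rw [monomial_mul, one_mul]
  ext x
  constructor
  · rintro ⟨m, hm, rfl⟩
    obtain ⟨h1, h2⟩ := support_add_squarefreeExponent hAB hm
    exact ⟨⟨m + squarefreeExponent A, hB.mono h2⟩, ⟨h1, h2⟩, (hmul m).symm⟩
  · rintro ⟨⟨m, hm⟩, ⟨h1, h2⟩, rfl⟩
    refine ⟨m - squarefreeExponent A, ?_, ?_⟩
    · exact fun i hi => h2 (by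
        simp only [Finsupp.mem_support_iff, Finsupp.tsub_apply] at hi ⊢
        omega)
    · rw [hmul, tsub_add_cancel_of_le]
      · rfl
      · intro i
        by_cases hi : i ∈ A
        · rw [squarefreeExponent_apply_of_mem hi]
          exact Nat.one_le_iff_ne_zero.2 (Finsupp.mem_support_iff.1 (h1 hi))
        · rw [squarefreeExponent_apply_of_notMem hi]
          exact Nat.zero_le _

/-- Multiplication by `x^A` only shifts exponents, and the shifted supports stay inside the
independent set `B`, so no term falls into the ideal. -/
lemma isFreeOn_squarefree {A B : Finset V} (hAB : A ⊆ B) (hB : IsIndependent G B) :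
    IsFreeOn K
      (Ideal.Quotient.mk (edgeIdeal K G) (monomial (squarefreeExponent A) (1 : K))) B := by
  intro p hp h0
  change Ideal.Quotient.mk _ (_ * _) = _ at h0
  rw [Ideal.Quotient.eq_zero_iff_mem, mem_edgeIdeal_iff] at h0
  by_contra hne
  obtain ⟨m, hm⟩ := support_nonempty.2 hne
  refine h0 (m + squarefreeExponent A) ?_ (hB.mono
    (support_add_squarefreeExponent hAB ?_).2)
  · rw [mem_support_iff, coeff_mul_monomial, mul_one]
    exact mem_support_iff.1 hm
  · intro i hi
    exact mem_supported.1 hp (Finset.mem_coe.2 ((mem_vars_iff_mem_support i).2 ⟨m, hm, hi⟩))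

lemma iSupIndep_span_image {ι κ M : Type*} [AddCommGroup M] [Module K M] {b : κ → M}
    (hb : LinearIndependent K b) {s : ι → Set κ} (hs : ∀ i j, i ≠ j → Disjoint (s i) (s j)) :
    iSupIndep fun i => Submodule.span K (b '' s i) := by
  intro i
  simp only [← Submodule.span_iUnion, ← Set.image_iUnion]
  refine hb.disjoint_span_image ?_
  simp only [Set.disjoint_iUnion_right]
  exact fun j hj => hs i j hj.symm

lemma exists_stanleyDecomposition [Fintype V] {d : ℕ}
    (h : HasIntervalPartition G Finset.univ d) :
    ∃ D : StanleyDecomposition (quotientGrading (edgeIdeal K G)), d ≤ D.sdepth := by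
  obtain ⟨P, hP, hP'⟩ := h
  set e := P.equivFin.symm
  let S (i : Fin P.card) : Set {m : V →₀ ℕ // IsIndependent G m.support} :=
    {m | (e i).1.1 ⊆ m.1.support ∧ m.1.support ⊆ (e i).1.2}
  have hspace (i : Fin P.card) := stanleySpace_squarefree (K := K) (G := G)
    (hP _ (e i).2).1 (hP _ (e i).2).2.2.1
  let D : StanleyDecomposition (quotientGrading (edgeIdeal K G)) :=
    { s := P.card
      v := fun i => Ideal.Quotient.mk _ (monomial (squarefreeExponent (e i).1.1) (1 : K))
      W := fun i => (e i).1.2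
      homogeneous := fun i => ⟨fun x => squarefreeExponent (e i).1.1 x,
        Submodule.subset_span ⟨_, fun _ => rfl, rfl⟩⟩
      free := fun i => isFreeOn_squarefree (hP _ (e i).2).1 (hP _ (e i).2).2.2.1
      isInternal := by
        simp only [hspace]
        apply DirectSum.isInternal_submodule_of_iSupIndep_of_iSup_eq_top
        · refine iSupIndep_span_image linearIndependent_standardMonomial (s := S) ?_
          intro i j hij
          rw [Set.disjoint_left]
          intro m hi hj
          refine hij (e.injective (Subtype.ext ?_))
          exact (hP' m.1.support (Finset.subset_univ _) m.2).unique
            ⟨(e i).2, hi⟩ ⟨(e j).2, hj⟩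
        · rw [← Submodule.span_iUnion, ← Set.image_iUnion, eq_top_iff,
            ← span_standardMonomial, ← Set.image_univ]
          refine Submodule.span_mono (Set.image_mono ?_)
          intro m _
          obtain ⟨p, ⟨hp, h1⟩, -⟩ := hP' m.1.support (Finset.subset_univ _) m.2
          obtain ⟨i, hi⟩ := e.surjective ⟨p, hp⟩
          refine Set.mem_iUnion.2 ⟨i, ?_⟩
          simpa only [Set.mem_ofPred_eq, hi] using h1 }
  refine ⟨D, ?_⟩
  -- An infimum over no summands would be `0`; the interval containing `∅` supplies one.
  obtain ⟨p, ⟨hp, -⟩, -⟩ := hP' ∅ (Finset.subset_univ _) (by simp [IsIndependent])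
  have : Nonempty (Fin D.s) := ⟨e.symm ⟨p, hp⟩⟩
  exact le_ciInf fun i => (hP _ (e i).2).2.2.2

lemma StanleyDecomposition.nonempty_fin {σ M : Type*} [AddCommGroup M] [Module K M]
    [Module (MvPolynomial σ K) M] [Nontrivial M] {ℳ : (σ → ℤ) → Submodule K M}
    (D : StanleyDecomposition ℳ) : Nonempty (Fin D.s) := by
  by_contra hE
  rw [not_nonempty_iff] at hE
  have := D.isInternal.submodule_iSup_eq_top
  rw [iSup_of_empty] at this
  exact bot_ne_top this

/-- Needed because `sSup` of an unbounded set of naturals is `0`. -/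
lemma bddAbove_sdepth {σ M : Type*} [Fintype σ] [AddCommGroup M] [Module K M]
    [Module (MvPolynomial σ K) M] [Nontrivial M] (ℳ : (σ → ℤ) → Submodule K M) :
    BddAbove (Set.range fun D : StanleyDecomposition ℳ => D.sdepth) := by
  refine ⟨Fintype.card σ, ?_⟩
  rintro _ ⟨D, rfl⟩
  obtain ⟨i⟩ := D.nonempty_fin
  exact (ciInf_le (OrderBot.bddBelow _) i).trans (Finset.card_le_univ _)

lemma nontrivial_quotient_edgeIdeal : Nontrivial (MvPolynomial V K ⧸ edgeIdeal K G) := by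
  rw [Ideal.Quotient.nontrivial_iff, Ne, Ideal.eq_top_iff_one, mem_edgeIdeal_iff]
  intro h
  exact h 0 (by simp) (by simp [IsIndependent])

lemma le_sdepth_of_hasIntervalPartition [Fintype V] {d : ℕ}
    (h : HasIntervalPartition G Finset.univ d) :
    d ≤ sdepth (quotientGrading (edgeIdeal K G)) := by
  have := nontrivial_quotient_edgeIdeal (K := K) (G := G)
  obtain ⟨D, hD⟩ := exists_stanleyDecomposition (K := K) h
  exact hD.trans (le_csSup (bddAbove_sdepth _) ⟨D, rfl⟩)

/-- A free Stanley space of `S/I(G)` only involves pairwise nonadjacent variables. -/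
lemma IsFreeOn.isIndependent {v : MvPolynomial V K ⧸ edgeIdeal K G} {W : Finset V}
    (h : IsFreeOn K v W) : IsIndependent G W := by
  intro i hi j hj hij
  have h0 : (X i * X j : MvPolynomial V K) = 0 := by
    refine h _ (mul_mem (X_mem_supported.2 hi) (X_mem_supported.2 hj)) ?_
    obtain ⟨q, rfl⟩ := Ideal.Quotient.mk_surjective v
    change Ideal.Quotient.mk _ (_ * _) = _
    rw [Ideal.Quotient.eq_zero_iff_mem]
    exact Ideal.mul_mem_right _ _ (Ideal.subset_span ⟨i, j, hij, rfl⟩)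
  exact mul_ne_zero (X_ne_zero i) (X_ne_zero j) h0

lemma sdepth_le_of_forall_card_le {d : ℕ}
    (h : ∀ F : Finset V, IsIndependent G F → F.card ≤ d) :
    sdepth (quotientGrading (edgeIdeal K G)) ≤ d := by
  have := nontrivial_quotient_edgeIdeal (K := K) (G := G)
  refine csSup_le' ?_
  rintro _ ⟨D, rfl⟩
  obtain ⟨i⟩ := D.nonempty_fin
  exact (ciInf_le (OrderBot.bddBelow _) i).trans (h _ (D.free i).isIndependent)

end Algebra

lemma IsIndependent.card_le_one_of_cyclePower {n k : ℕ} (hnk : n ≤ 2 * k + 1)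
    {F : Finset (Fin n)} (hF : IsIndependent (cyclePower n k) F) : F.card ≤ 1 := by
  refine Finset.card_le_one.2 fun i hi j hj => ?_
  by_contra hne
  refine hF i hi j hj (cyclePower_adj_iff.2 ⟨hne, ?_⟩)
  omega

end StanleyDepth

theorem theorem4p6 (K : Type*) [Field K] (n k : ℕ) (hn : 3 ≤ n) (hk : 1 ≤ k) :
    (n ≤ 2 * k + 1 →
      StanleyDepth.sdepth
        (StanleyDepth.quotientGrading
          (StanleyDepth.edgeIdeal K (StanleyDepth.cyclePower n k))) = 1) ∧
    (2 * k + 2 ≤ n →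
      ⌈((n : ℚ) - (k : ℚ)) / (2 * (k : ℚ) + 1)⌉ ≤
        ((StanleyDepth.sdepth
          (StanleyDepth.quotientGrading
            (StanleyDepth.edgeIdeal K (StanleyDepth.cyclePower n k))) : ℕ) : ℤ)) := by
  constructor
  · intro hnk
    refine le_antisymm (StanleyDepth.sdepth_le_of_forall_card_le fun F hF =>
      hF.card_le_one_of_cyclePower hnk) ?_
    exact StanleyDepth.le_sdepth_of_hasIntervalPartition
      (StanleyDepth.hasIntervalPartition_one ⟨⟨0, by omega⟩, Finset.mem_univ _⟩)
  · intro hnk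
    have hdiv := Nat.div_add_mod (n + k) (2 * k + 1)
    have hmod := Nat.mod_lt (n + k) (Nat.succ_pos (2 * k))
    have hle := StanleyDepth.le_sdepth_of_hasIntervalPartition (K := K)
      (StanleyDepth.hasIntervalPartition_cyclePower (n := n) (k := k)
        (d := (n + k) / (2 * k + 1)) (by omega) (Nat.mul_div_le _ _))
    refine le_trans ?_ (Int.ofNat_le.2 hle)
    rw [Int.ceil_le, div_le_iff₀ (by positivity)]
    -- The remainder of `n + k` modulo `2k + 1` is at most `2k`.
    have h : n ≤ (2 * k + 1) * ((n + k) / (2 * k + 1)) + k := by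
      simp only [Nat.succ_eq_add_one] at hmod
      omega
    have h' : (n : ℚ) ≤ (2 * k + 1) * (((n + k) / (2 * k + 1) : ℕ) : ℚ) + k := by
      exact_mod_cast h
    simp only [Int.cast_natCast]
    linarith
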